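/- Let $R$ be an associative ring with unit (not necessarily commutative), let $R\text{-}\mathrm{Mod}$ be the category of left $R$-modules, $\mathscr{C}(R)$ the category of ($\mathbb{Z}$-indexed) complexes of left $R$-modules, and $\mathscr{K}(R)$ its homotopy category. An object $M$ of an abelian category $\mathscr{A}$ is called Gorenstein projective if there is an exact complex $\cdots\to P_{-1}\to P_0\to P_1\to\cdots$ of projective objects of $\mathscr{A}$ that stays exact under $\mathrm{Hom}_{\mathscr{A}}(-,Q)$ for every projective object $Q$, and such that $M\cong\mathrm{Ker}(P_0\to P_1)$; $\mathcal{GP}_{\mathscr{A}}$ denotes the class of these objects. For a class $\mathcal{L}$ of objects of $\mathscr{A}$, let $\mathcal{L}^{\perp}$ be the class of objects $N$ with $\mathrm{Ext}^1_{\mathscr{A}}(L,N)=0$ for all $L\in\mathcal{L}$. For a class $\mathcal{G}$ of modules, let $\widetilde{\mathcal{G}}$ be the class of exact complexes all of whose cycle modules belong to $\mathcal{G}$. Then, for every ring $R$, one has $$\mathcal{GP}_{\mathscr{C}(R)}^{\perp}=\widetilde{\mathcal{GP}_{R\text{-}\mathrm{Mod}}^{\perp}}$$ if and only if $\mathrm{Hom}_{\mathscr{K}(R)}(M,N)=0$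 for every Gorenstein projective complex $M$ (i.e. $M\in\mathcal{GP}_{\mathscr{C}(R)}$) and every complex $N\in\widetilde{\mathcal{GP}_{R\text{-}\mathrm{Mod}}^{\perp}}$. -/

import Mathlib

open CategoryTheory CategoryTheory.Limits

universe v u

namespace GorProj

section

variable {A : Type u} [Category.{v} A] [Abelian A]

/-- A complex `P` is `Hom(-, 𝒫)`-exact, where `𝒫` is the class of projective objects: for every
projective object `Q`, the complex of abelian groups `Hom(P, Q)` is exact, i.e. for every `n`,
every `f : Pⁿ ⟶ Q` with `Pⁿ⁻¹ ⟶ Pⁿ ⟶ Q` zero extends along `Pⁿ ⟶ Pⁿ⁺¹`. -/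
def HomProjExact (P : CochainComplex A ℤ) : Prop :=
  ∀ (Q : A), Projective Q → ∀ (n : ℤ) (f : P.X n ⟶ Q), P.d (n - 1) n ≫ f = 0 →
    ∃ g : P.X (n + 1) ⟶ Q, P.d n (n + 1) ≫ g = f

variable (A) in
/-- The class of Gorenstein projective objects of an abelian category: the objects `M` that are
(isomorphic to) the kernel of `P⁰ ⟶ P¹` for some exact and `Hom(-, 𝒫)`-exact complex `P` of
projective objects. -/
def gorensteinProjective : ObjectProperty A := fun M =>
  ∃ P : CochainComplex A ℤ,
    (∀ n, Projective (P.X n)) ∧ P.Acyclic ∧ HomProjExact P ∧ Nonempty (M ≅ kernel (P.d 0 1))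

/-- The right orthogonal class `ℒ^⊥` of a class of objects `ℒ`: all objects `N` such that
`Ext¹(L, N) = 0` for every `L` in `ℒ`. (The vanishing does not depend on the universe in which
the groups `Ext¹` are taken; the largest natural one works in any abelian category.) -/
def extOrthogonal (L : ObjectProperty A) : ObjectProperty A := fun N =>
  haveI : HasExt.{max u v} A := HasExt.standard A
  ∀ M : A, L M → Subsingleton (Abelian.Ext.{max u v} M N 1)

/-- The class `ℒ~` of exact complexes all of whose cycle objects `Ker dⁿ` belong to `ℒ`. -/
def exactWithCyclesIn (L : ObjectProperty A) : ObjectProperty (CochainComplex A ℤ) := fun X =>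
  X.Acyclic ∧ ∀ n, L (X.cycles n)

end

end GorProj

/-! Write GP for Gorenstein projective. A GP complex `M` embeds in a projective complex with GP
cokernel, so every map from `M` to an `N` in the orthogonal of the GP complexes factors through a
projective complex. Projective complexes are contractible, hence the map is null-homotopic
(`isNullHomotopic_of_extOrthogonal`).

Conversely, one inclusion needs no hypothesis (`exactWithCyclesIn_of_extOrthogonal`). For projective
`P` with `d ≫ d = 0`, the complex with `d` in every degree is GP: it is both kernel and cokernel in
a short exact sequence around a sum of disks on `P`. Any complex of projectives is a retract of such
a complex, so all its maps to an orthogonal `N` are null-homotopic. Testing with `d = 0` gives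
exactness of `N`; testing with totally acyclic complexes shows that the cycles of `N` are orthogonal
to GP modules.

The other inclusion uses vanishing in the homotopy category: a null-homotopic map from a GP complex
extends to a projective complex by extending its homotopy component by component
(`extOrthogonal_of_exactWithCyclesIn`). -/

namespace GorProj

open Abelian

/-! ### Totally acyclic complexes, GP objects and extension of morphisms. -/

section Abelian

variable {A : Type u} [Category.{v} A] [Abelian A]

/-- The complex `Hom(P, N)` is exact. -/
def HomExact (P : CochainComplex A ℤ) (N : A) : Prop :=
  ∀ ⦃i j k : ℤ⦄, i + 1 = j → j + 1 = k → ∀ f : P.X j ⟶ N, P.d i j ≫ f = 0 →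
    ∃ g : P.X k ⟶ N, P.d j k ≫ g = f

/-- Totally acyclic complexes of projective objects. -/
structure IsTotallyAcyclic (P : CochainComplex A ℤ) : Prop where
  projective : ∀ n, Projective (P.X n)
  acyclic : P.Acyclic
  homExact : ∀ Q : A, Projective Q → HomExact P Q

lemma homProjExact_iff (P : CochainComplex A ℤ) :
    HomProjExact P ↔ ∀ Q : A, Projective Q → HomExact P Q := by
  constructor
  · rintro h Q hQ i j k rfl rfl f hf
    have := h Q hQ (i + 1) f
    rw [show i + 1 - 1 = i by ring] at this
    exact this hf
  · intro h Q hQ n f hf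
    exact h Q hQ (by ring) rfl f hf

/-- The complex `P` with its degrees translated by `k`, with unchanged differentials. -/
@[simps]
def translate (P : CochainComplex A ℤ) (k : ℤ) : CochainComplex A ℤ where
  X i := P.X (i + k)
  d i j := P.d (i + k) (j + k)
  shape i j h := P.shape _ _ (fun h' => h (by simp only [ComplexShape.up_Rel] at h' ⊢; omega))

lemma exact_of_exactAt {P : CochainComplex A ℤ} {i j k : ℤ} (hi : i + 1 = j) (hk : j + 1 = k)
    (h : P.ExactAt j) : (ShortComplex.mk (P.d i j) (P.d j k) (P.d_comp_d _ _ _)).Exact :=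
  (P.exactAt_iff' i j k (by simp; omega) (by simp; omega)).1 h

lemma exactAt_of_exact {P : CochainComplex A ℤ} {i j k : ℤ} (hi : i + 1 = j) (hk : j + 1 = k)
    (h : (ShortComplex.mk (P.d i j) (P.d j k) (P.d_comp_d _ _ _)).Exact) : P.ExactAt j :=
  (P.exactAt_iff' i j k (by simp; omega) (by simp; omega)).2 h

lemma IsTotallyAcyclic.translate {P : CochainComplex A ℤ} (hP : IsTotallyAcyclic P) (k : ℤ) :
    IsTotallyAcyclic (translate P k) where
  projective n := hP.projective _
  acyclic n := exactAt_of_exact (sub_add_cancel n 1) rfl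
    (exact_of_exactAt (P := P) (by ring) (by ring) (hP.acyclic (n + k)))
  homExact Q hQ i j l hi hl f hf :=
    hP.homExact Q hQ (i := i + k) (j := j + k) (k := l + k) (by omega) (by omega) f hf

/-- The cycles of a complex are the kernel of the differential. -/
noncomputable def cyclesIsoKernel (P : CochainComplex A ℤ) {i j : ℤ} (h : i + 1 = j) :
    P.cycles i ≅ kernel (P.d i j) :=
  (P.cyclesIsKernel i j (by simp; omega)).conePointUniqueUpToIso (limit.isLimit _)

lemma gorensteinProjective_iff (M : A) : gorensteinProjective A M ↔
    ∃ P : CochainComplex A ℤ, IsTotallyAcyclic P ∧ Nonempty (M ≅ P.cycles 0) := by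
  constructor
  · rintro ⟨P, h1, h2, h3, ⟨e⟩⟩
    exact ⟨P, ⟨h1, h2, (homProjExact_iff P).1 h3⟩, ⟨e ≪≫ (cyclesIsoKernel P (by simp)).symm⟩⟩
  · rintro ⟨P, hP, ⟨e⟩⟩
    exact ⟨P, hP.1, hP.2, (homProjExact_iff P).2 hP.3, ⟨e ≪≫ (cyclesIsoKernel P (by simp))⟩⟩

lemma IsTotallyAcyclic.gorensteinProjective_cycles {P : CochainComplex A ℤ}
    (hP : IsTotallyAcyclic P) (n : ℤ) : gorensteinProjective A (P.cycles n) := by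
  refine (gorensteinProjective_iff _).2 ⟨_, hP.translate n, ⟨?_⟩⟩
  refine cyclesIsoKernel P rfl ≪≫ ?_ ≪≫ (cyclesIsoKernel (GorProj.translate P n) (zero_add 1)).symm
  exact kernel.mapIso _ _ (P.XIsoOfEq (zero_add n).symm) (P.XIsoOfEq (add_comm n 1))
    ((P.d_comp_XIsoOfEq_hom _ _).trans (P.XIsoOfEq_hom_comp_d _ _).symm)

/-- The short complex `Zⁱ ⟶ Pⁱ ⟶ Zʲ`, of interest for `j = i + 1`. -/
noncomputable abbrev cyclesShortComplex (P : CochainComplex A ℤ) (i j : ℤ) : ShortComplex A :=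
  ShortComplex.mk (P.iCycles i) (P.toCycles i j) (by simp [← cancel_mono (P.iCycles j)])

lemma epi_toCycles {P : CochainComplex A ℤ} {i j : ℤ} (h : i + 1 = j) (hP : P.ExactAt j) :
    Epi (P.toCycles i j) := by
  have h' : Epi (P.sc' i j (j + 1)).toCycles := (exact_of_exactAt h rfl hP).epi_toCycles
  rw [← P.toCycles_cyclesIsoSc'_hom i j (j + 1) (by simp; omega) (by simp)] at h'
  exact ((MorphismProperty.epimorphisms A).cancel_right_of_respectsIso _ _).1 h'

lemma cyclesShortComplex_shortExact {P : CochainComplex A ℤ} {i j : ℤ} (h : i + 1 = j)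
    (hP : P.ExactAt j) : (cyclesShortComplex P i j).ShortExact where
  exact := by
    apply ShortComplex.exact_of_f_is_kernel
    refine KernelFork.IsLimit.ofι' _ _ (fun {B} g hg => ⟨P.liftCycles g j (by simp; omega) ?_, ?_⟩)
    · rw [← P.toCycles_i, reassoc_of% hg, zero_comp]
    · simp
  epi_g := epi_toCycles h hP

lemma extOrthogonal_iff (L : ObjectProperty A) (N : A) :
    extOrthogonal L N ↔ haveI : HasExt.{max u v} A := HasExt.standard A
      ∀ M : A, L M → Subsingleton (Ext.{max u v} M N 1) := Iff.rfl

lemma exists_extension {L : ObjectProperty A} {N : A} (hN : extOrthogonal L N)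
    {S : ShortComplex A} (hS : S.ShortExact) (h₃ : L S.X₃) (f : S.X₁ ⟶ N) :
    ∃ g : S.X₂ ⟶ N, S.f ≫ g = f := by
  have : HasExt.{max u v} A := HasExt.standard A
  have := hN _ h₃
  obtain ⟨x, hx⟩ := Ext.contravariant_sequence_exact₁ hS _ (Ext.mk₀ f) (n₁ := 1) rfl
    (Subsingleton.elim _ _)
  obtain ⟨g, rfl⟩ := Ext.homEquiv₀.symm.surjective x
  refine ⟨g, Ext.homEquiv₀.symm.injective ?_⟩
  simpa using hx

lemma extOrthogonal_of_exists_extension {L : ObjectProperty A} {N : A}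
    (h : ∀ M, L M → ∃ (S : ShortComplex A) (_ : S.ShortExact) (_ : Projective S.X₂)
      (_ : M ≅ S.X₃), ∀ f : S.X₁ ⟶ N, ∃ g : S.X₂ ⟶ N, S.f ≫ g = f) :
    extOrthogonal L N := by
  rw [extOrthogonal_iff]
  intro M hM
  have : HasExt.{max u v} A := HasExt.standard A
  obtain ⟨S, hS, hP, e, hf⟩ := h M hM
  suffices Subsingleton (Ext.{max u v} S.X₃ N 1) from by
    refine subsingleton_of_forall_eq 0 (fun x => ?_)
    have h0 : (Ext.mk₀ e.inv).comp x (zero_add 1) = 0 := Subsingleton.elim _ _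
    have := congrArg (fun y => (Ext.mk₀ e.hom).comp y (zero_add 1)) h0
    simpa using this
  refine subsingleton_of_forall_eq 0 (fun x => ?_)
  obtain ⟨y, rfl⟩ := Ext.contravariant_sequence_exact₃ hS _ x (Ext.eq_zero_of_projective _)
    (n₀ := 0) rfl
  obtain ⟨f, rfl⟩ := Ext.homEquiv₀.symm.surjective y
  obtain ⟨g, rfl⟩ := hf f
  have : Ext.homEquiv₀.symm (S.f ≫ g) = (Ext.mk₀ S.f).comp (Ext.mk₀ g) (zero_add 0) := by simp
  rw [this]
  exact hS.extClass_comp_assoc _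

lemma extOrthogonal_of_shortExact {L : ObjectProperty A} {S : ShortComplex A} (hS : S.ShortExact)
    (h₁ : extOrthogonal L S.X₁) (h₃ : extOrthogonal L S.X₃) : extOrthogonal L S.X₂ := by
  rw [extOrthogonal_iff] at *
  intro M hM
  have : HasExt.{max u v} A := HasExt.standard A
  have := h₁ M hM
  have := h₃ M hM
  refine subsingleton_of_forall_eq 0 (fun x => ?_)
  obtain ⟨y, rfl⟩ := Ext.covariant_sequence_exact₂ _ hS x (Subsingleton.elim _ _)
  rw [Subsingleton.elim y 0]
  simp

lemma exists_shortExact_right {M : A} (hM : gorensteinProjective A M) :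
    ∃ (S : ShortComplex A) (_ : S.ShortExact) (_ : Projective S.X₂) (_ : M ≅ S.X₁),
      gorensteinProjective A S.X₃ := by
  obtain ⟨P, hP, ⟨e⟩⟩ := (gorensteinProjective_iff M).1 hM
  exact ⟨_, cyclesShortComplex_shortExact (zero_add 1) (hP.acyclic 1), hP.projective _, e,
    hP.gorensteinProjective_cycles _⟩

/-- A cocycle on `P.X j` factors through `P.cycles k`, whose inclusion into `P.X k` has GP cokernel.
-/
lemma homExact_of_extOrthogonal {N : A} (hN : extOrthogonal (gorensteinProjective A) N)
    {P : CochainComplex A ℤ} (hP : IsTotallyAcyclic P) : HomExact P N := by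
  rintro i j k hi hk f hf
  have := epi_toCycles hi (hP.acyclic j)
  have hS := cyclesShortComplex_shortExact hi (hP.acyclic j)
  have hS' := cyclesShortComplex_shortExact hk (hP.acyclic k)
  have hS'' := cyclesShortComplex_shortExact rfl (hP.acyclic (k + 1))
  have := hS'.epi_g
  have h0 : P.iCycles j ≫ f = 0 := by
    rw [← cancel_epi (P.toCycles i j), P.toCycles_i_assoc, hf, comp_zero]
  obtain ⟨f', hf'⟩ : ∃ f' : P.cycles k ⟶ N, P.toCycles j k ≫ f' = f :=
    ⟨hS'.exact.desc f h0, hS'.exact.g_desc f h0⟩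
  obtain ⟨g, hg⟩ := exists_extension hN hS'' (hP.gorensteinProjective_cycles _) f'
  refine ⟨g, ?_⟩
  rw [← hf', ← hg, P.toCycles_i_assoc]

lemma extOrthogonal_of_forall_extension {N : A}
    (h : ∀ P : CochainComplex A ℤ, IsTotallyAcyclic P → ∀ f : P.X (-2) ⟶ N,
      P.d (-3) (-2) ≫ f = 0 → ∃ g : P.X (-1) ⟶ N, P.d (-2) (-1) ≫ g = f) :
    extOrthogonal (gorensteinProjective A) N := by
  apply extOrthogonal_of_exists_extension
  intro M hM
  obtain ⟨P, hP, ⟨e⟩⟩ := (gorensteinProjective_iff M).1 hM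
  -- `M` is the cycle object in degree 0, so its projective presentation has middle term `P.X (-1)`
  -- and kernel the cycles in degree -1, themselves a quotient of `P.X (-2)`.
  refine ⟨_, cyclesShortComplex_shortExact (neg_add_cancel 1) (hP.acyclic 0), hP.projective _, e,
    fun f => ?_⟩
  have := epi_toCycles (show (-2 : ℤ) + 1 = -1 by norm_num) (hP.acyclic _)
  obtain ⟨g, hg⟩ := h P hP (P.toCycles _ _ ≫ f) (by simp)
  refine ⟨g, ?_⟩
  rw [← cancel_epi (P.toCycles (-2) (-1)), ← hg]
  simp

end Abelian

/-! ### Sums of disks, and passage between a category and its complexes. -/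

section Disks

variable {A : Type u} [Category.{v} A] [Abelian A]

/-- The direct sum of all the disks on an object `L`: the contractible complex which is `L ⊞ L` in
each degree, with the differential given by `(x, y) ↦ (0, x)`. -/
noncomputable def disks (L : A) : CochainComplex A ℤ where
  X _ := L ⊞ L
  d i j := if i + 1 = j then biprod.fst ≫ biprod.inr else 0
  shape i j h := if_neg h
  d_comp_d' i j k (hij : i + 1 = j) (hjk : j + 1 = k) := by
    rw [if_pos hij, if_pos hjk]; simp

namespace disks

/-- The first inclusion `L ⟶ L ⊞ L`. -/
noncomputable def inl (L : A) (n : ℤ) : L ⟶ (disks L).X n := (biprod.inl : L ⟶ L ⊞ L)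

/-- The second inclusion `L ⟶ L ⊞ L`. -/
noncomputable def inr (L : A) (n : ℤ) : L ⟶ (disks L).X n := (biprod.inr : L ⟶ L ⊞ L)

/-- The first projection `L ⊞ L ⟶ L`. -/
noncomputable def fst (L : A) (n : ℤ) : (disks L).X n ⟶ L := (biprod.fst : L ⊞ L ⟶ L)

/-- The second projection `L ⊞ L ⟶ L`. -/
noncomputable def snd (L : A) (n : ℤ) : (disks L).X n ⟶ L := (biprod.snd : L ⊞ L ⟶ L)

@[simp]
lemma inl_fst (L : A) (n : ℤ) : inl L n ≫ fst L n = 𝟙 L := biprod.inl_fst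

@[simp]
lemma inl_fst_assoc (L : A) (n : ℤ) {B : A} (h : L ⟶ B) : inl L n ≫ fst L n ≫ h = h := by
  rw [← Category.assoc, inl_fst, Category.id_comp]

@[simp]
lemma inl_snd (L : A) (n : ℤ) : inl L n ≫ snd L n = 0 := biprod.inl_snd

@[simp]
lemma inl_snd_assoc (L : A) (n : ℤ) {B : A} (h : L ⟶ B) : inl L n ≫ snd L n ≫ h = 0 := by
  rw [← Category.assoc, inl_snd, zero_comp]

@[simp]
lemma inr_fst (L : A) (n : ℤ) : inr L n ≫ fst L n = 0 := biprod.inr_fst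

@[simp]
lemma inr_fst_assoc (L : A) (n : ℤ) {B : A} (h : L ⟶ B) : inr L n ≫ fst L n ≫ h = 0 := by
  rw [← Category.assoc, inr_fst, zero_comp]

@[simp]
lemma inr_snd (L : A) (n : ℤ) : inr L n ≫ snd L n = 𝟙 L := biprod.inr_snd

@[simp]
lemma inr_snd_assoc (L : A) (n : ℤ) {B : A} (h : L ⟶ B) : inr L n ≫ snd L n ≫ h = h := by
  rw [← Category.assoc, inr_snd, Category.id_comp]

lemma d_eq (L : A) {i j : ℤ} (h : i + 1 = j) : (disks L).d i j = fst L i ≫ inr L j := if_pos h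

lemma inl_d (L : A) {i j : ℤ} (h : i + 1 = j) : inl L i ≫ (disks L).d i j = inr L j := by
  simp [d_eq L h]

lemma d_snd (L : A) {i j : ℤ} (h : i + 1 = j) : (disks L).d i j ≫ snd L j = fst L i := by
  simp [d_eq L h]

lemma hom_ext_from {L B : A} {n : ℤ} {f g : (disks L).X n ⟶ B} (h₁ : inl L n ≫ f = inl L n ≫ g)
    (h₂ : inr L n ≫ f = inr L n ≫ g) : f = g := biprod.hom_ext' _ _ h₁ h₂

lemma hom_ext_to {L B : A} {n : ℤ} {f g : B ⟶ (disks L).X n} (h₁ : f ≫ fst L n = g ≫ fst L n)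
    (h₂ : f ≫ snd L n = g ≫ snd L n) : f = g := biprod.hom_ext _ _ h₁ h₂

variable {L : A} {X : CochainComplex A ℤ}

/-- The morphism of complexes `disks L ⟶ X` given by a family of morphisms `L ⟶ Xⁿ`. -/
noncomputable def desc (h : ∀ n, L ⟶ X.X n) : disks L ⟶ X where
  f n := fst L n ≫ h n + snd L n ≫ h (n - 1) ≫ X.d (n - 1) n
  comm' i j hij := by
    obtain rfl : i + 1 = j := hij
    have : ∀ k, k = i → h k ≫ X.d k (i + 1) = h i ≫ X.d i (i + 1) := by rintro _ rfl; rfl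
    simp [d_eq L rfl, this (i + 1 - 1) (by ring)]

@[simp]
lemma inl_desc (h : ∀ n, L ⟶ X.X n) (n : ℤ) : inl L n ≫ (desc h).f n = h n := by
  simp [desc]

@[simp]
lemma inl_desc_assoc (h : ∀ n, L ⟶ X.X n) (n : ℤ) {B : A} (g : X.X n ⟶ B) :
    inl L n ≫ (desc h).f n ≫ g = h n ≫ g := by
  rw [← Category.assoc, inl_desc]

lemma inr_f (f : disks L ⟶ X) {i j : ℤ} (h : i + 1 = j) :
    inr L j ≫ f.f j = inl L i ≫ f.f i ≫ X.d i j := by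
  rw [← inl_d L h, Category.assoc, f.comm]

lemma hom_ext {f g : disks L ⟶ X} (h : ∀ n, inl L n ≫ f.f n = inl L n ≫ g.f n) : f = g := by
  ext n : 1
  refine hom_ext_from (h n) ?_
  rw [inr_f f (sub_add_cancel n 1), inr_f g (sub_add_cancel n 1), reassoc_of% h (n - 1)]

/-- The morphism of complexes `X ⟶ disks L` given by a family of morphisms `Xⁿ ⟶ L`. -/
noncomputable def lift (k : ∀ n, X.X n ⟶ L) : X ⟶ disks L where
  f n := X.d n (n + 1) ≫ k (n + 1) ≫ inl L n + k n ≫ inr L n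
  comm' i j hij := by
    obtain rfl : i + 1 = j := hij
    simp [d_eq L rfl]

@[simp]
lemma lift_snd (k : ∀ n, X.X n ⟶ L) (n : ℤ) : (lift k).f n ≫ snd L n = k n := by
  simp [lift]

lemma f_fst (f : X ⟶ disks L) {i j : ℤ} (h : i + 1 = j) :
    f.f i ≫ fst L i = X.d i j ≫ f.f j ≫ snd L j := by
  rw [← d_snd L h, f.comm_assoc]

lemma hom_ext' {f g : X ⟶ disks L} (h : ∀ n, f.f n ≫ snd L n = g.f n ≫ snd L n) : f = g := by
  ext n : 1
  refine hom_ext_to ?_ (h n)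
  rw [f_fst f rfl, f_fst g rfl, h]

/-- The functoriality of the complexes `disks`. -/
noncomputable def map {L M : A} (f : L ⟶ M) : disks L ⟶ disks M := desc (fun n => f ≫ inl M n)

@[simp]
lemma inl_map {L M : A} (f : L ⟶ M) (n : ℤ) : inl L n ≫ (map f).f n = f ≫ inl M n :=
  inl_desc _ _

@[simp]
lemma inl_map_assoc {L M : A} (f : L ⟶ M) (n : ℤ) {B : A} (g : (disks M).X n ⟶ B) :
    inl L n ≫ (map f).f n ≫ g = f ≫ inl M n ≫ g := by
  rw [← Category.assoc, inl_map, Category.assoc]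

@[simp]
lemma inr_map {L M : A} (f : L ⟶ M) (n : ℤ) : inr L n ≫ (map f).f n = f ≫ inr M n := by
  rw [inr_f _ (sub_add_cancel n 1), inl_map_assoc, inl_d M (sub_add_cancel n 1)]

@[simp]
lemma inr_map_assoc {L M : A} (f : L ⟶ M) (n : ℤ) {B : A} (g : (disks M).X n ⟶ B) :
    inr L n ≫ (map f).f n ≫ g = f ≫ inr M n ≫ g := by
  rw [← Category.assoc, inr_map, Category.assoc]

@[simp]
lemma map_fst {L M : A} (f : L ⟶ M) (n : ℤ) : (map f).f n ≫ fst M n = fst L n ≫ f :=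
  hom_ext_from (by simp) (by simp)

@[simp]
lemma map_snd {L M : A} (f : L ⟶ M) (n : ℤ) : (map f).f n ≫ snd M n = snd L n ≫ f :=
  hom_ext_from (by simp) (by simp)

instance epi_map {L M : A} (f : L ⟶ M) [Epi f] : Epi (map f) where
  left_cancellation g h w := hom_ext (fun n => by
    have := inl L n ≫= HomologicalComplex.congr_hom w n
    simpa only [HomologicalComplex.comp_f, inl_map_assoc, cancel_epi] using this)

instance (Q : A) [Projective Q] : Projective (disks Q) where
  factors {E B} f e _ :=
    ⟨desc (fun n => Projective.factorThru (inl Q n ≫ f.f n) (e.f n)), hom_ext (fun n => by simp)⟩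

lemma exact_map {S : ShortComplex A} (hS : S.Exact) :
    (ShortComplex.mk (map S.f) (map S.g) (hom_ext (fun n => by simp))).Exact := by
  apply HomologicalComplex.exact_of_degreewise_exact
  intro n
  rw [ShortComplex.exact_iff_exact_up_to_refinements] at hS ⊢
  intro B (x : B ⟶ (disks S.X₂).X n) (hx : x ≫ (map S.g).f n = 0)
  obtain ⟨B₁, p₁, _, y₁, h₁⟩ := hS (x ≫ fst _ _) (by simpa using hx =≫ fst _ _)
  obtain ⟨B₂, p₂, _, y₂, h₂⟩ := hS (p₁ ≫ x ≫ snd _ _) (by simpa using p₁ ≫= hx =≫ snd _ _)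
  refine ⟨B₂, p₂ ≫ p₁, epi_comp _ _, p₂ ≫ y₁ ≫ inl _ n + y₂ ≫ inr _ n, ?_⟩
  change (p₂ ≫ p₁) ≫ x = _ ≫ (map S.f).f n
  exact hom_ext_to (by simp [h₁]) (by simp [h₂])

end disks

/-- Morphisms into `disks E` amount to arbitrary families of morphisms into `E`, so a lifting
problem in degree `n` becomes one for complexes, with zero data in the other degrees. -/
lemma projective_X (P : CochainComplex A ℤ) [Projective P] (n : ℤ) : Projective (P.X n) where
  factors {E B} f e he := by
    obtain ⟨g, hg⟩ := Projective.factors (disks.lift (Function.update 0 n f)) (disks.map e)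
    exact ⟨g.f n ≫ disks.snd E n,
      by simpa using HomologicalComplex.congr_hom hg n =≫ disks.snd B n⟩

/-- The complex of sums of disks on the terms of a complex. -/
noncomputable abbrev disksComplex (P : CochainComplex A ℤ) :
    CochainComplex (CochainComplex A ℤ) ℤ where
  X i := disks (P.X i)
  d i j := disks.map (P.d i j)
  shape i j h := disks.hom_ext (fun n => by simp [P.shape i j h])
  d_comp_d' i j k _ _ := disks.hom_ext (fun n => by simp)

/-- The complex of terms of degree `n` of a complex of complexes. -/
abbrev evalComplex (P : CochainComplex (CochainComplex A ℤ) ℤ) (n : ℤ) : CochainComplex A ℤ where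
  X i := (P.X i).X n
  d i j := (P.d i j).f n
  shape i j h := by simp [P.shape i j h]
  d_comp_d' i j k _ _ := by simp [← HomologicalComplex.comp_f]

variable {P : CochainComplex A ℤ}

lemma homExact_disksComplex_iff (N : CochainComplex A ℤ) :
    HomExact (disksComplex P) N ↔ ∀ n, HomExact P (N.X n) := by
  constructor
  · intro h n i j k hi hk f hf
    obtain ⟨g, hg⟩ := h hi hk (disks.desc (Function.update 0 n f)) (disks.hom_ext (fun m => by
      by_cases hm : m = n
      · subst hm; simp [hf]
      · simp [hm]))
    refine ⟨disks.inl _ n ≫ g.f n, ?_⟩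
    simpa using disks.inl _ n ≫= HomologicalComplex.congr_hom hg n
  · intro h i j k hi hk f hf
    have h' (n : ℤ) := h n hi hk (disks.inl _ n ≫ f.f n) (by
      simpa using disks.inl _ n ≫= HomologicalComplex.congr_hom hf n)
    choose g hg using h'
    exact ⟨disks.desc g, disks.hom_ext (fun n => by simp [hg])⟩

lemma IsTotallyAcyclic.disksComplex (hP : IsTotallyAcyclic P) :
    IsTotallyAcyclic (disksComplex P) where
  projective n := by
    have := hP.projective n
    dsimp only
    infer_instance
  acyclic n := exactAt_of_exact (sub_add_cancel n 1) rfl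
    (disks.exact_map (exact_of_exactAt (sub_add_cancel n 1) rfl (hP.acyclic n)))
  homExact Q _ := (homExact_disksComplex_iff Q).2 (fun n => hP.homExact _ (projective_X Q n))

lemma IsTotallyAcyclic.evalComplex {P : CochainComplex (CochainComplex A ℤ) ℤ}
    (hP : IsTotallyAcyclic P) (n : ℤ) : IsTotallyAcyclic (evalComplex P n) where
  projective i := by
    have := hP.projective i
    exact projective_X _ n
  acyclic i := exactAt_of_exact (sub_add_cancel i 1) rfl
    ((HomologicalComplex.exact_iff_degreewise_exact _).1
      (exact_of_exactAt (sub_add_cancel i 1) rfl (hP.acyclic i)) n)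
  homExact Q _ i j k hi hk f hf := by
    -- `disks Q` is a projective complex, and maps into it concentrated on the index `n` encode maps
    -- from the terms of degree `n` to `Q`.
    obtain ⟨g, hg⟩ := hP.homExact (disks Q) inferInstance hi hk (disks.lift (Function.update 0 n f))
      (disks.hom_ext' (fun m => by
        by_cases hm : m = n
        · subst hm; simpa using hf
        · simp [hm]))
    refine ⟨g.f n ≫ disks.snd _ n, ?_⟩
    simpa using HomologicalComplex.congr_hom hg n =≫ disks.snd _ n

lemma gorensteinProjective_X {M : CochainComplex A ℤ}
    (hM : gorensteinProjective (CochainComplex A ℤ) M) (n : ℤ) :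
    gorensteinProjective A (M.X n) := by
  obtain ⟨P, hP, ⟨e⟩⟩ := (gorensteinProjective_iff _).1 hM
  refine (gorensteinProjective_iff _).2 ⟨_, hP.evalComplex n, ⟨?_⟩⟩
  exact (HomologicalComplex.eval A _ n).mapIso e ≪≫
    ((P.sc 0).mapCyclesIso (HomologicalComplex.eval A _ n)).symm

lemma extOrthogonal_X {N : CochainComplex A ℤ}
    (hN : extOrthogonal (gorensteinProjective (CochainComplex A ℤ)) N) (n : ℤ) :
    extOrthogonal (gorensteinProjective A) (N.X n) :=
  extOrthogonal_of_forall_extension (fun P hP =>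
    (homExact_disksComplex_iff N).1 (homExact_of_extOrthogonal hN hP.disksComplex) n
      (by norm_num) (by norm_num))

end Disks

/-! ### Null-homotopic maps, contractibility of projectives, and constant complexes. -/

section NullHomotopic

variable {A : Type u} [Category.{v} A] [Abelian A]

/-- A morphism of complexes is null-homotopic if it is of the form `d s + s d`. -/
def IsNullHomotopic {X Y : CochainComplex A ℤ} (φ : X ⟶ Y) : Prop :=
  ∃ s : ∀ i j, X.X i ⟶ Y.X j, Homotopy.nullHomotopicMap s = φ

namespace IsNullHomotopic

variable {X Y Z : CochainComplex A ℤ} {φ : X ⟶ Y}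

lemma comp (h : IsNullHomotopic φ) (ψ : Y ⟶ Z) : IsNullHomotopic (φ ≫ ψ) := by
  obtain ⟨s, rfl⟩ := h
  exact ⟨_, (Homotopy.nullHomotopicMap_comp s ψ).symm⟩

lemma precomp (h : IsNullHomotopic φ) (ψ : Z ⟶ X) : IsNullHomotopic (ψ ≫ φ) := by
  obtain ⟨s, rfl⟩ := h
  exact ⟨_, (Homotopy.comp_nullHomotopicMap ψ s).symm⟩

end IsNullHomotopic

lemma nullHomotopicMap_f_eq {X Y : CochainComplex A ℤ} (s : ∀ i j, X.X i ⟶ Y.X j) (n : ℤ) :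
    (Homotopy.nullHomotopicMap s).f n =
      X.d n (n + 1) ≫ s (n + 1) n + s n (n - 1) ≫ Y.d (n - 1) n :=
  Homotopy.nullHomotopicMap_f (by simp) (by simp) s

lemma isNullHomotopic_iff {X Y : CochainComplex A ℤ} (φ : X ⟶ Y) :
    IsNullHomotopic φ ↔ (HomotopyCategory.quotient A (ComplexShape.up ℤ)).map φ = 0 := by
  rw [HomotopyCategory.quotient_map_eq_zero_iff]
  constructor
  · rintro ⟨s, rfl⟩
    -- `s` may be nonzero away from adjacent degrees; `nullHomotopy'` discards those components,
    -- which do not contribute to the map.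
    refine ⟨(Homotopy.ofEq ?_).trans (Homotopy.nullHomotopy' (fun i j _ => s i j))⟩
    ext n
    rw [nullHomotopicMap_f_eq, Homotopy.nullHomotopicMap'_f (k₂ := n - 1) (k₀ := n + 1)
      (by simp) (by simp)]
  · rintro ⟨h⟩
    refine ⟨h.hom, ?_⟩
    ext n
    have := h.comm n
    rw [HomologicalComplex.zero_f_apply, add_zero] at this
    exact this.symm

lemma isNullHomotopic_id_disks (L : A) : IsNullHomotopic (𝟙 (disks L)) := by
  refine ⟨fun i j => disks.snd L i ≫ disks.inl L j, ?_⟩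
  ext n
  rw [nullHomotopicMap_f_eq, Category.assoc, disks.inl_d L (sub_add_cancel n 1),
    ← Category.assoc, disks.d_snd L rfl]
  exact disks.hom_ext_from (by simp) (by simp)

/-- A projective complex is a retract of a contractible sum of disks that surjects onto it. -/
lemma isNullHomotopic_id_of_projective [HasCoproductsOfShape ℤ A] (Q : CochainComplex A ℤ)
    [Projective Q] : IsNullHomotopic (𝟙 Q) := by
  let p : disks (∐ Q.X) ⟶ Q := disks.desc (fun n => Sigma.π Q.X n)
  have (n : ℤ) : Epi (p.f n) :=
    epi_of_epi_fac (disks.inl_desc (X := Q) (fun n => Sigma.π Q.X n) n)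
  have : Epi p := HomologicalComplex.epi_of_epi_f p this
  obtain ⟨q, hq⟩ := Projective.factors (𝟙 Q) p
  rw [← hq, ← Category.id_comp p]
  exact ((isNullHomotopic_id_disks _).comp p).precomp _

/-- The complex which is a given differential object in each degree. -/
abbrev constComplex {C : Type*} [Category* C] [HasZeroMorphisms C] {P : C} (d : P ⟶ P)
    (hd : d ≫ d = 0) : CochainComplex C ℤ where
  X _ := P
  d i j := if i + 1 = j then d else 0
  shape i j h := if_neg h
  d_comp_d' i j k (hij : i + 1 = j) (hjk : j + 1 = k) := by
    rw [if_pos hij, if_pos hjk, hd]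

lemma isTotallyAcyclic_constComplex {P : A} [Projective P] {d : P ⟶ P} {hd : d ≫ d = 0}
    (h : (ShortComplex.mk d d hd).Exact)
    (h' : ∀ Q : A, Projective Q → ∀ f : P ⟶ Q, d ≫ f = 0 → ∃ g : P ⟶ Q, d ≫ g = f) :
    IsTotallyAcyclic (constComplex d hd) where
  projective _ := inferInstance
  acyclic n := exactAt_of_exact (sub_add_cancel n 1) rfl
    (ShortComplex.exact_of_iso (ShortComplex.isoMk (Iso.refl P) (Iso.refl P) (Iso.refl P)
      (by simp) (by simp)) h)
  homExact Q hQ i j k hi hk f hf := by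
    obtain ⟨g, hg⟩ := h' Q hQ f (by simpa [hi] using hf)
    exact ⟨g, by simpa [hk] using hg⟩

section

variable {P : A} (d : P ⟶ P) (hd : d ≫ d = 0)

/-- The embedding of a constant complex into a contractible complex. -/
noncomputable def constι : constComplex d hd ⟶ disks P := disks.lift (fun _ => 𝟙 P)

/-- The presentation of a constant complex as a quotient of a contractible complex. -/
noncomputable def constπ : disks P ⟶ constComplex d hd := disks.desc (fun n => n.negOnePow • 𝟙 P)

lemma constι_f (n : ℤ) : (constι d hd).f n = d ≫ disks.inl P n + disks.inr P n := by
  simp [constι, disks.lift]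

lemma constπ_f (n : ℤ) :
    (constπ d hd).f n = n.negOnePow • (disks.fst P n - disks.snd P n ≫ d) := by
  simp [constπ, disks.desc, Int.negOnePow_sub, smul_sub]
  rw [sub_eq_add_neg]

/-- The alternating sign in `constπ` makes the two contributions of `d` cancel. -/
lemma constι_constπ : constι d hd ≫ constπ d hd = 0 := by
  ext n
  simp [constι_f, constπ_f]

instance : Mono (constι d hd) where
  right_cancellation f g h := by
    ext n
    simpa [constι_f] using HomologicalComplex.congr_hom h n =≫ disks.snd P n

instance : Epi (constπ d hd) where
  left_cancellation f g h := by
    ext n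
    simpa [constπ_f] using disks.inl P n ≫= HomologicalComplex.congr_hom h n

lemma const_shortExact : (ShortComplex.mk _ _ (constι_constπ d hd)).ShortExact where
  exact := by
    apply HomologicalComplex.exact_of_degreewise_exact
    intro n
    rw [ShortComplex.exact_iff_exact_up_to_refinements]
    intro B (x : B ⟶ (disks P).X n) (hx : x ≫ (constπ d hd).f n = 0)
    refine ⟨B, 𝟙 B, inferInstance, x ≫ disks.snd P n, ?_⟩
    change 𝟙 B ≫ x = (x ≫ disks.snd P n) ≫ (constι d hd).f n
    have hx' : x ≫ disks.fst P n = x ≫ disks.snd P n ≫ d := by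
      rw [← sub_eq_zero]
      simpa [constπ_f, smul_eq_zero_iff_eq] using hx
    exact disks.hom_ext_to (by simp [constι_f, hx']) (by simp [constι_f])

lemma constπ_constι_comp_self :
    (constπ d hd ≫ constι d hd) ≫ constπ d hd ≫ constι d hd = 0 := by
  rw [Category.assoc, reassoc_of% constι_constπ d hd, zero_comp, comp_zero]

lemma exact_constπ_constι :
    (ShortComplex.mk _ _ (constπ_constι_comp_self d hd)).Exact := by
  rw [ShortComplex.exact_iff_exact_up_to_refinements]
  intro B x hx
  dsimp at x hx
  have hx' : x ≫ constπ d hd = 0 := by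
    rw [← cancel_mono (constι d hd), Category.assoc, hx, zero_comp]
  obtain ⟨B', p, hp, z, hz⟩ := surjective_up_to_refinements_of_epi (constπ d hd)
    ((const_shortExact d hd).exact.lift x hx')
  refine ⟨B', p, hp, z, ?_⟩
  have := (const_shortExact d hd).exact.lift_f x hx'
  dsimp at this hz ⊢
  rw [← reassoc_of% hz, this]

variable {d hd} in
lemma exists_extension_of_isNullHomotopic {N : CochainComplex A ℤ} {φ : constComplex d hd ⟶ N}
    (h : IsNullHomotopic φ) : ∃ g : disks P ⟶ N, constι d hd ≫ g = φ := by
  obtain ⟨s, rfl⟩ := h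
  -- All terms of the source equal `P`, so `s (n + 1) n` is a map from `P` to `N.X n`, as
  -- `disks.desc` requires.
  refine ⟨disks.desc (fun n => s (n + 1) n), ?_⟩
  ext n
  have : ∀ m, m = n → (s m (n - 1) : P ⟶ _) = s n (n - 1) := by rintro _ rfl; rfl
  rw [nullHomotopicMap_f_eq, HomologicalComplex.comp_f, constι_f, Preadditive.add_comp,
    Category.assoc, disks.inl_desc, disks.inr_f _ (sub_add_cancel n 1), disks.inl_desc_assoc,
    this _ (sub_add_cancel n 1)]
  simp

/-- Splicing copies of the sequence of `const_shortExact` gives this complex. Maps from the constant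
complex to a projective `Q` are null-homotopic, as `Q` is contractible, hence extend along `constι`.
-/
lemma isTotallyAcyclic_disks [HasCoproductsOfShape ℤ A] [Projective P] :
    IsTotallyAcyclic (constComplex _ (constπ_constι_comp_self d hd)) :=
  isTotallyAcyclic_constComplex (exact_constπ_constι d hd) (fun Q _ f hf => by
    have hf' : constι d hd ≫ f = 0 := by
      rw [← cancel_epi (constπ d hd), ← Category.assoc, hf, comp_zero]
    have := (const_shortExact d hd).epi_g
    obtain ⟨f', hf'⟩ : ∃ f', constπ d hd ≫ f' = f :=
      ⟨_, (const_shortExact d hd).exact.g_desc f hf'⟩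
    have := (isNullHomotopic_id_of_projective Q).precomp f'
    rw [Category.comp_id] at this
    obtain ⟨g, hg⟩ := exists_extension_of_isNullHomotopic this
    exact ⟨g, by rw [Category.assoc, hg, hf']⟩)

lemma isNullHomotopic_from_constComplex [HasCoproductsOfShape ℤ A] [Projective P]
    {N : CochainComplex A ℤ}
    (hN : extOrthogonal (gorensteinProjective (CochainComplex A ℤ)) N)
    (φ : constComplex d hd ⟶ N) : IsNullHomotopic φ := by
  obtain ⟨g, hg⟩ := homExact_of_extOrthogonal hN (isTotallyAcyclic_disks d hd)
    (zero_add 1) rfl (constπ d hd ≫ φ) (by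
      simp [reassoc_of% constι_constπ d hd])
  have : constι d hd ≫ g = φ := by
    simpa [cancel_epi] using hg
  rw [← this, ← Category.id_comp g]
  exact ((isNullHomotopic_id_disks P).comp g).precomp _

end

section

variable [HasCoproductsOfShape ℤ A] (X : CochainComplex A ℤ)

/-- The differential on the direct sum of all the terms of a complex. -/
noncomputable def totalD : ∐ X.X ⟶ ∐ X.X :=
  Sigma.desc (fun n => X.d n (n + 1) ≫ Sigma.ι X.X (n + 1))

@[simp]
lemma ι_totalD (n : ℤ) :
    Sigma.ι X.X n ≫ totalD X = X.d n (n + 1) ≫ Sigma.ι X.X (n + 1) :=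
  Sigma.ι_desc _ _

@[simp]
lemma ι_totalD_assoc (n : ℤ) {B : A} (g : ∐ X.X ⟶ B) :
    Sigma.ι X.X n ≫ totalD X ≫ g = X.d n (n + 1) ≫ Sigma.ι X.X (n + 1) ≫ g := by
  rw [← Category.assoc, ι_totalD, Category.assoc]

lemma totalD_comp_self : totalD X ≫ totalD X = 0 := Sigma.hom_ext _ _ (fun n => by simp)

lemma totalD_π (n : ℤ) :
    totalD X ≫ Sigma.π X.X (n + 1) = Sigma.π X.X n ≫ X.d n (n + 1) :=
  Sigma.hom_ext _ _ (fun m => by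
    by_cases h : m = n
    · subst h
      rw [ι_totalD_assoc, Sigma.ι_π_eq_id, ← Category.assoc, Sigma.ι_π_eq_id, Category.comp_id,
        Category.id_comp]
    · rw [ι_totalD_assoc, Sigma.ι_π_of_ne _ (by simpa using h), ← Category.assoc,
        Sigma.ι_π_of_ne _ h, comp_zero, zero_comp])

/-- The inclusion of a complex into the sum of all its translates. -/
noncomputable def totalι : X ⟶ constComplex (totalD X) (totalD_comp_self X) where
  f n := Sigma.ι X.X n
  comm' i j (hij : i + 1 = j) := by subst hij; simp

/-- The projection onto a complex of the sum of all its translates. -/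
noncomputable def totalπ : constComplex (totalD X) (totalD_comp_self X) ⟶ X where
  f n := Sigma.π X.X n
  comm' i j (hij : i + 1 = j) := by subst hij; simp [totalD_π]

lemma totalι_totalπ : totalι X ≫ totalπ X = 𝟙 X := by
  ext n
  exact Sigma.ι_π_eq_id _ n

variable {X}

/-- `X` is a retract of the constant complex on the projective object `∐ X.X`. -/
lemma isNullHomotopic_of_projective_X (hX : ∀ n, Projective (X.X n)) {N : CochainComplex A ℤ}
    (hN : extOrthogonal (gorensteinProjective (CochainComplex A ℤ)) N) (φ : X ⟶ N) :
    IsNullHomotopic φ := by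
  have : Projective (∐ X.X) :=
    { factors f e _ := ⟨Sigma.desc (fun n => Projective.factorThru (Sigma.ι X.X n ≫ f) e),
        Sigma.hom_ext _ _ (fun n => by simp)⟩ }
  have := (isNullHomotopic_from_constComplex _ _ hN (totalπ X ≫ φ)).precomp (totalι X)
  rwa [← Category.assoc, totalι_totalπ, Category.id_comp] at this

end

end NullHomotopic

/-! ### The two inclusions and the vanishing of homotopy classes. -/

section

variable {A : Type u} [Category.{v} A] [Abelian A]

lemma acyclic_of_extOrthogonal [HasCoproductsOfShape ℤ A] [EnoughProjectives A]
    {N : CochainComplex A ℤ}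
    (hN : extOrthogonal (gorensteinProjective (CochainComplex A ℤ)) N) : N.Acyclic := by
  intro n
  apply exactAt_of_exact (sub_add_cancel n 1) rfl
  rw [ShortComplex.exact_iff_exact_up_to_refinements]
  intro B x hx
  dsimp at x hx
  -- With zero differential, a cycle in the single degree `n` is already a chain map, and a
  -- null-homotopy exhibits it as a boundary.
  let φ : constComplex (0 : Projective.over B ⟶ Projective.over B) comp_zero ⟶ N :=
    { f := Function.update 0 n (Projective.π B ≫ x)
      comm' i j (hij : i + 1 = j) := by
        subst hij
        by_cases h : i = n
        · subst h; simp [hx]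
        · simp [h] }
  obtain ⟨s, hs⟩ := isNullHomotopic_from_constComplex _ _ hN φ
  refine ⟨_, Projective.π B, inferInstance, s n (n - 1), ?_⟩
  have := HomologicalComplex.congr_hom hs n
  rw [nullHomotopicMap_f_eq] at this
  simpa [φ] using this.symm

/-- A morphism of complexes can be constructed by extending a given morphism in a single degree,
provided that it can be extended step by step in both directions. -/
lemma exists_hom_of_step {P N : CochainComplex A ℤ}
    (up : ∀ (k : ℤ) (g : P.X k ⟶ N.X k), P.d (k - 1) k ≫ g ≫ N.d k (k + 1) = 0 →
      ∃ g' : P.X (k + 1) ⟶ N.X (k + 1), P.d k (k + 1) ≫ g' = g ≫ N.d k (k + 1))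
    (down : ∀ (k : ℤ) (g : P.X k ⟶ N.X k), P.d (k - 1) k ≫ g ≫ N.d k (k + 1) = 0 →
      ∃ g' : P.X (k - 1) ⟶ N.X (k - 1), g' ≫ N.d (k - 1) k = P.d (k - 1) k ≫ g)
    (m : ℤ) (g : P.X m ⟶ N.X m) (hg : P.d (m - 1) m ≫ g ≫ N.d m (m + 1) = 0) :
    ∃ φ : P ⟶ N, φ.f m = g := by
  classical
  -- The default 0 is never used: `zero_up` and `zero_down` propagate the condition that permits
  -- each further step.
  let succ (k : ℤ) (_ : m ≤ k) (g : P.X k ⟶ N.X k) : P.X (k + 1) ⟶ N.X (k + 1) :=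
    if h : P.d (k - 1) k ≫ g ≫ N.d k (k + 1) = 0 then (up k g h).choose else 0
  let pred (k : ℤ) (_ : k ≤ m) (g : P.X k ⟶ N.X k) : P.X (k - 1) ⟶ N.X (k - 1) :=
    if h : P.d (k - 1) k ≫ g ≫ N.d k (k + 1) = 0 then (down k g h).choose else 0
  let φ (k : ℤ) : P.X k ⟶ N.X k :=
    Int.inductionOn' (motive := fun k => P.X k ⟶ N.X k) k m g succ pred
  have φ_self : φ m = g := Int.inductionOn'_self
  have φ_succ (k : ℤ) (hk : m ≤ k) (h : P.d (k - 1) k ≫ φ k ≫ N.d k (k + 1) = 0) :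
      P.d k (k + 1) ≫ φ (k + 1) = φ k ≫ N.d k (k + 1) := by
    have h' : φ (k + 1) = succ k hk (φ k) := Int.inductionOn'_add_one hk
    rw [h']
    simp only [succ, dif_pos h]
    exact (up k (φ k) h).choose_spec
  have φ_pred (k : ℤ) (hk : k ≤ m) (h : P.d (k - 1) k ≫ φ k ≫ N.d k (k + 1) = 0) :
      φ (k - 1) ≫ N.d (k - 1) k = P.d (k - 1) k ≫ φ k := by
    have h' : φ (k - 1) = pred k hk (φ k) := Int.inductionOn'_sub_one hk
    rw [h']
    simp only [pred, dif_pos h]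
    exact (down k (φ k) h).choose_spec
  have zero_self : P.d (m - 1) m ≫ φ m ≫ N.d m (m + 1) = 0 := by rw [φ_self, hg]
  have zero_up (k : ℤ) (hk : m ≤ k) :
      ∀ i j, i + 1 = k → k + 1 = j → P.d i k ≫ φ k ≫ N.d k j = 0 := by
    induction k, hk using Int.leInduction with
    | base => rintro i _ hi rfl; obtain rfl : i = m - 1 := by omega
              exact zero_self
    | succ k hk ih =>
      rintro i j hi hj
      obtain rfl : i = k := by omega
      rw [← Category.assoc, φ_succ i hk (ih _ _ (by omega) rfl), Category.assoc, N.d_comp_d,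
        comp_zero]
  have zero_down (k : ℤ) (hk : k ≤ m) :
      ∀ i j, i + 1 = k → k + 1 = j → P.d i k ≫ φ k ≫ N.d k j = 0 := by
    induction k, hk using Int.leInductionDown with
    | base => rintro i _ hi rfl; obtain rfl : i = m - 1 := by omega
              exact zero_self
    | pred k hk ih =>
      rintro i j hi hj
      obtain rfl : j = k := by omega
      rw [φ_pred j hk (ih _ _ (by omega) rfl), P.d_comp_d_assoc, zero_comp]
  refine ⟨⟨φ, ?_⟩, φ_self⟩
  rintro i j (hij : i + 1 = j)
  rcases le_or_gt m i with hi | hi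
  · subst hij
    exact (φ_succ i hi (zero_up _ hi _ _ (by omega) rfl)).symm
  · obtain rfl : i = j - 1 := by omega
    exact φ_pred j (by omega) (zero_down _ (by omega) _ _ (by omega) rfl)

/-- Extend `f` to a map `g` into `N.X m`, then `g` to a chain map. In degree `m` a null-homotopy
writes `g` as `d s + s d`; precomposing with the differential of `P` kills the first term, so `s d`,
which lands in the cycles, also extends `f`. -/
lemma exists_extension_to_cycles {N : CochainComplex A ℤ} (hN : N.Acyclic)
    (hN' : ∀ n, extOrthogonal (gorensteinProjective A) (N.X n)) {P : CochainComplex A ℤ}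
    (hP : IsTotallyAcyclic P) (h : ∀ φ : P ⟶ N, IsNullHomotopic φ) {m : ℤ}
    (f : P.X (m - 1) ⟶ N.cycles m) (hf : P.d (m - 2) (m - 1) ≫ f = 0) :
    ∃ g : P.X m ⟶ N.cycles m, P.d (m - 1) m ≫ g = f := by
  obtain ⟨g, hg⟩ := homExact_of_extOrthogonal (hN' m) hP (show m - 2 + 1 = m - 1 by ring)
    (sub_add_cancel m 1) (f ≫ N.iCycles m) (by rw [reassoc_of% hf, zero_comp])
  obtain ⟨φ, hφ⟩ := exists_hom_of_step (P := P) (N := N)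
    (fun k g hg => homExact_of_extOrthogonal (hN' _) hP (sub_add_cancel k 1) rfl _ hg)
    (fun k g hg => by
      have := hP.projective (k - 1)
      have hS := exact_of_exactAt (sub_add_cancel k 1) rfl (hN k)
      exact ⟨hS.liftFromProjective (P.d (k - 1) k ≫ g) (by simpa using hg),
        hS.liftFromProjective_comp _ _⟩) m g (by
      rw [reassoc_of% hg, N.iCycles_d, comp_zero])
  obtain ⟨s, hs⟩ := h φ
  refine ⟨s m (m - 1) ≫ N.toCycles (m - 1) m, ?_⟩
  have := P.d (m - 1) m ≫= HomologicalComplex.congr_hom hs m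
  rw [nullHomotopicMap_f_eq, hφ, hg] at this
  rw [← cancel_mono (N.iCycles m)]
  simpa using this

lemma homExact_cycles {N : CochainComplex A ℤ} (hN : N.Acyclic)
    (hN' : ∀ n, extOrthogonal (gorensteinProjective A) (N.X n))
    (h : ∀ P : CochainComplex A ℤ, IsTotallyAcyclic P → ∀ φ : P ⟶ N, IsNullHomotopic φ)
    {P : CochainComplex A ℤ} (hP : IsTotallyAcyclic P) (m : ℤ) : HomExact P (N.cycles m) := by
  intro i j k hi hk f hf
  obtain ⟨t, rfl⟩ : ∃ t, k = m + t := ⟨k - m, by ring⟩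
  obtain rfl : j = m - 1 + t := by omega
  obtain rfl : i = m - 2 + t := by omega
  exact exists_extension_to_cycles hN hN' (hP.translate t) (h _ (hP.translate t)) f hf

lemma exactWithCyclesIn_of_extOrthogonal [HasCoproductsOfShape ℤ A] [EnoughProjectives A]
    {N : CochainComplex A ℤ}
    (hN : extOrthogonal (gorensteinProjective (CochainComplex A ℤ)) N) :
    exactWithCyclesIn (extOrthogonal (gorensteinProjective A)) N :=
  ⟨acyclic_of_extOrthogonal hN, fun n => extOrthogonal_of_forall_extension (fun _ hP =>
    homExact_cycles (acyclic_of_extOrthogonal hN) (extOrthogonal_X hN)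
      (fun _ hP => isNullHomotopic_of_projective_X hP.projective hN) hP n
      (by norm_num) (by norm_num))⟩

lemma extOrthogonal_of_exactWithCyclesIn {N : CochainComplex A ℤ}
    (hN : exactWithCyclesIn (extOrthogonal (gorensteinProjective A)) N)
    (h : ∀ M : CochainComplex A ℤ, gorensteinProjective (CochainComplex A ℤ) M →
      ∀ φ : M ⟶ N, IsNullHomotopic φ) :
    extOrthogonal (gorensteinProjective (CochainComplex A ℤ)) N := by
  have hN' (j : ℤ) : extOrthogonal (gorensteinProjective A) (N.X j) :=
    extOrthogonal_of_shortExact (cyclesShortComplex_shortExact rfl (hN.1 (j + 1)))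
      (hN.2 j) (hN.2 (j + 1))
  apply extOrthogonal_of_exists_extension
  intro M hM
  obtain ⟨P, hP, ⟨e⟩⟩ := (gorensteinProjective_iff M).1 hM
  have hS := cyclesShortComplex_shortExact (neg_add_cancel 1) (hP.acyclic 0)
  refine ⟨_, hS, hP.projective _, e, fun φ => ?_⟩
  obtain ⟨s, hs⟩ := h _ (hP.gorensteinProjective_cycles _) φ
  -- In each degree the cokernel of the inclusion is GP and `N.X j` is orthogonal to GP objects. The
  -- extended components need no compatibility, since any family defines a null-homotopic chain map.
  have hS' (i j : ℤ) : ∃ g : (P.X (-1)).X i ⟶ N.X j, (P.iCycles (-1)).f i ≫ g = s i j :=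
    exists_extension (hN' j)
    ((HomologicalComplex.shortExact_iff_degreewise_shortExact _).1 hS i)
    (gorensteinProjective_X (hP.gorensteinProjective_cycles 0) i) (s i j)
  choose s' hs' using hS'
  refine ⟨Homotopy.nullHomotopicMap s', ?_⟩
  refine (Homotopy.comp_nullHomotopicMap (P.iCycles (-1)) s').trans ?_
  rw [← hs]
  congr 1
  ext i j : 2
  exact hs' i j

lemma isNullHomotopic_of_extOrthogonal [HasCoproductsOfShape ℤ A] {M N : CochainComplex A ℤ}
    (hM : gorensteinProjective (CochainComplex A ℤ) M)
    (hN : extOrthogonal (gorensteinProjective (CochainComplex A ℤ)) N) (φ : M ⟶ N) :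
    IsNullHomotopic φ := by
  obtain ⟨S, hS, _, e, h₃⟩ := exists_shortExact_right hM
  obtain ⟨g, hg⟩ := exists_extension hN hS h₃ (e.inv ≫ φ)
  have : φ = (e.hom ≫ S.f) ≫ 𝟙 _ ≫ g := by simp [hg]
  rw [this]
  exact ((isNullHomotopic_id_of_projective S.X₂).comp g).precomp _

end

end GorProj

theorem proposition3 (R : Type u) [Ring R] :
    GorProj.extOrthogonal (GorProj.gorensteinProjective (CochainComplex (ModuleCat.{u} R) ℤ)) =
        GorProj.exactWithCyclesIn
          (GorProj.extOrthogonal (GorProj.gorensteinProjective (ModuleCat.{u} R))) ↔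
      ∀ M N : CochainComplex (ModuleCat.{u} R) ℤ,
        GorProj.gorensteinProjective (CochainComplex (ModuleCat.{u} R) ℤ) M →
        GorProj.exactWithCyclesIn
          (GorProj.extOrthogonal (GorProj.gorensteinProjective (ModuleCat.{u} R))) N →
        ∀ f : (HomotopyCategory.quotient (ModuleCat.{u} R) (ComplexShape.up ℤ)).obj M ⟶
            (HomotopyCategory.quotient (ModuleCat.{u} R) (ComplexShape.up ℤ)).obj N,
          f = 0 := by
  constructor
  · intro h M N hM hN f
    obtain ⟨φ, rfl⟩ := (HomotopyCategory.quotient _ _).map_surjective f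
    rw [← h] at hN
    exact (GorProj.isNullHomotopic_iff φ).1 (GorProj.isNullHomotopic_of_extOrthogonal hM hN φ)
  · intro h
    ext N
    exact ⟨GorProj.exactWithCyclesIn_of_extOrthogonal, fun hN =>
      GorProj.extOrthogonal_of_exactWithCyclesIn hN (fun M hM φ =>
        (GorProj.isNullHomotopic_iff φ).2 (h M N hM hN _))⟩
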